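/- Let $A,B,C$ be finite-dimensional quantum systems and let $\rho=\rho_{ABC}$ be an (unknown) density operator on $\mathcal H_A\otimes\mathcal H_B\otimes\mathcal H_C$, with given bipartite marginals $\rho_{AB},\rho_{BC},\rho_{AC}$ (partial traces). For each of the three pairs of marginals $\mathcal C\in\{\{\rho_{AB},\rho_{BC}\},\{\rho_{BC},\rho_{AC}\},\{\rho_{AB},\rho_{AC}\}\}$ let $\mathrm{Comp}(\mathcal C)$ be the set of all density operators on $\mathcal H_A\otimes\mathcal H_B\otimes\mathcal H_C$ whose two corresponding marginals are those in $\mathcal C$. Write $S(\sigma)=-\mathrm{Tr}[\sigma\log\sigma]$ for the von Neumann entropy, and $S(\rho\|\sigma)=\mathrm{Tr}[\rho(\log\rho-\log\sigma)]$ if $\mathrm{supp}\,\rho\subseteq\mathrm{supp}\,\sigma$, $S(\rho\|\sigma)=+\infty$ otherwise, for the relative entropy. Then for each $\mathcal C$ there is a unique maximum entropy estimator $\widetilde\rho_{\mathcal C}$, i.e. a unique element of $\mathrm{Comp}(\mathcal C)$ of maximal von Neumann entropy, and $$S(\rho\,\|\,\widetilde\rho_{\mathcal C})=S(\widetilde\rho_{\mathcal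 C})-S(\rho)$$ (in particular the left side is finite). Consequently, among the three estimators, those closest to $\rho$ in relative entropy are exactly those of minimal von Neumann entropy: $$\operatorname*{arg\,min}_{\mathcal C}S(\rho\,\|\,\widetilde\rho_{\mathcal C})=\operatorname*{arg\,min}_{\mathcal C}S(\widetilde\rho_{\mathcal C}).$$ -/

import Mathlib

/-!
Finite-dimensional quantum systems are written in orthonormal bases: a system `A` with basis indexed
by the finite type `a` has operators `Matrix a a ℂ`, and the tripartite system `ABC` has operators
`Matrix (a × b × c) (a × b × c) ℂ`.
-/

open scoped ComplexOrder

namespace Quantum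

/-- A density operator: positive semidefinite (in particular Hermitian) with trace one. -/
structure IsDensity {n : Type*} [Fintype n] (ρ : Matrix n n ℂ) : Prop where
  posSemidef : ρ.PosSemidef
  trace_eq_one : ρ.trace = 1

/-- The logarithm of a Hermitian matrix, by the functional calculus. Since `Real.log 0 = 0`, on
positive semidefinite matrices it is the logarithm on the support and `0` on the kernel. -/
noncomputable def matLog {n : Type*} [Fintype n] [DecidableEq n] (ρ : Matrix n n ℂ) :
    Matrix n n ℂ :=
  cfc Real.log ρ

/-- The von Neumann entropy `S(ρ) = -Tr[ρ log ρ]` (natural logarithm, `0 log 0 = 0`). -/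
noncomputable def entropy {n : Type*} [Fintype n] [DecidableEq n] (ρ : Matrix n n ℂ) : ℝ :=
  -(ρ * matLog ρ).trace.re

open scoped Classical in
/-- The von Neumann relative entropy `S(ρ‖σ)`: it is `Tr[ρ (log ρ - log σ)]` if the kernel of `σ` is
contained in the kernel of `ρ` (that is, `supp ρ ⊆ supp σ`), and `+∞` otherwise. -/
noncomputable def relEntropy {n : Type*} [Fintype n] [DecidableEq n] (ρ σ : Matrix n n ℂ) :
    EReal :=
  if ∀ v : n → ℂ, σ.mulVec v = 0 → ρ.mulVec v = 0 then
    (((ρ * (matLog ρ - matLog σ)).trace.re : ℝ) : EReal)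
  else ⊤

section Tripartite

variable {a b c : Type*} [Fintype a] [Fintype b] [Fintype c]

/-- The marginal on `AB`: the partial trace over `C`. -/
def marginalAB (ρ : Matrix (a × b × c) (a × b × c) ℂ) : Matrix (a × b) (a × b) ℂ :=
  fun i j => ∑ k : c, ρ (i.1, i.2, k) (j.1, j.2, k)

/-- The marginal on `BC`: the partial trace over `A`. -/
def marginalBC (ρ : Matrix (a × b × c) (a × b × c) ℂ) : Matrix (b × c) (b × c) ℂ :=
  fun i j => ∑ k : a, ρ (k, i.1, i.2) (k, j.1, j.2)

/-- The marginal on `AC`: the partial trace over `B`. -/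
def marginalAC (ρ : Matrix (a × b × c) (a × b × c) ℂ) : Matrix (a × c) (a × c) ℂ :=
  fun i j => ∑ k : b, ρ (i.1, k, i.2) (j.1, k, j.2)

end Tripartite

/-- The three possible pairs `{XY, YZ}` of bipartite marginals of a tripartite system. -/
inductive MarginalPair : Type
  | AB_BC
  | BC_AC
  | AB_AC

/-- The compatibility set of a pair of marginals taken out of three given bipartite operators
`ρAB`, `ρBC`, `ρAC`: the density operators on `ABC` whose two corresponding marginals are the given
ones. -/
def Comp {a b c : Type*} [Fintype a] [Fintype b] [Fintype c]
    (ρAB : Matrix (a × b) (a × b) ℂ) (ρBC : Matrix (b × c) (b × c) ℂ)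
    (ρAC : Matrix (a × c) (a × c) ℂ) :
    MarginalPair → Set (Matrix (a × b × c) (a × b × c) ℂ)
  | .AB_BC => {σ | IsDensity σ ∧ marginalAB σ = ρAB ∧ marginalBC σ = ρBC}
  | .BC_AC => {σ | IsDensity σ ∧ marginalBC σ = ρBC ∧ marginalAC σ = ρAC}
  | .AB_AC => {σ | IsDensity σ ∧ marginalAB σ = ρAB ∧ marginalAC σ = ρAC}

/-- `σ` is a maximum von Neumann entropy estimator for the set `K` of compatible density
operators: it belongs to `K` and has the largest von Neumann entropy in `K`. -/
def IsMaxEntropyEstimator {n : Type*} [Fintype n] [DecidableEq n] (K : Set (Matrix n n ℂ))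
    (σ : Matrix n n ℂ) : Prop :=
  σ ∈ K ∧ ∀ τ ∈ K, entropy τ ≤ entropy σ

end Quantum

/-! Each compatibility set `K` is a compact affine section of the density operators, and only this
is used. Let `σ` maximize entropy on `K`, let `ρ ∈ K` and `σ_t = (1-t)σ + tρ`. Maximality says `Tr σ
log σ ≤ Tr σ_t log σ_t`, and Klein's inequality (`klein`) says `Tr σ log σ_t ≤ Tr σ log σ`; together
they give `Tr ρ log σ_t ≥ Tr σ log σ`, with no derivative of the entropy. Letting `t → 0` forces
`supp ρ ⊆ supp σ` and `Tr ρ log σ ≥ Tr σ log σ`. The support inclusion gives `ρ ≤ Mσ`, so the line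
from `ρ` to `σ` stays in `K` a little beyond `σ`. The same inequality at a point there is the
reverse one, so `Tr ρ log σ = Tr σ log σ` (`IsMaxEntropyEstimator.re_trace_mul_matLog_eq`), which is
the Pythagorean identity. If `ρ` is a maximizer too, the equality case of Klein's inequality gives
`ρ = σ`. -/

namespace Quantum

open Matrix Filter Topology

/-! ### Operators in the eigenbasis of a Hermitian matrix -/

section SpectralWeights

variable {n : Type*} [Fintype n] [DecidableEq n]

/-- The operator `ρ` written in the eigenbasis of the Hermitian matrix `σ`. -/
noncomputable def inEigenbasis {σ : Matrix n n ℂ} (hσ : σ.IsHermitian) (ρ : Matrix n n ℂ) :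
    Matrix n n ℂ :=
  star (hσ.eigenvectorUnitary : Matrix n n ℂ) * ρ * (hσ.eigenvectorUnitary : Matrix n n ℂ)

/-- The diagonal entries of `ρ` in the eigenbasis of the Hermitian matrix `σ`. -/
noncomputable def eigenWeight {σ : Matrix n n ℂ} (hσ : σ.IsHermitian) (ρ : Matrix n n ℂ) (j : n) :
    ℝ :=
  (inEigenbasis hσ ρ j j).re

section Eigenbasis

variable {σ : Matrix n n ℂ} (hσ : σ.IsHermitian)

lemma eigenvectorUnitary_mul_star :
    (hσ.eigenvectorUnitary : Matrix n n ℂ) * star (hσ.eigenvectorUnitary : Matrix n n ℂ) = 1 :=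
  Unitary.coe_mul_star_self _

lemma star_mul_eigenvectorUnitary :
    star (hσ.eigenvectorUnitary : Matrix n n ℂ) * (hσ.eigenvectorUnitary : Matrix n n ℂ) = 1 :=
  Unitary.coe_star_mul_self _

lemma cfc_eq_conj_diagonal (f : ℝ → ℝ) :
    cfc f σ = (hσ.eigenvectorUnitary : Matrix n n ℂ) *
      diagonal (fun i => (f (hσ.eigenvalues i) : ℂ)) *
      star (hσ.eigenvectorUnitary : Matrix n n ℂ) := by
  rw [hσ.cfc_eq, IsHermitian.cfc, Unitary.conjStarAlgAut_apply]
  rfl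

lemma eq_conj_diagonal :
    σ = (hσ.eigenvectorUnitary : Matrix n n ℂ) *
      diagonal (fun i => (hσ.eigenvalues i : ℂ)) *
      star (hσ.eigenvectorUnitary : Matrix n n ℂ) := by
  have h := hσ.spectral_theorem
  rw [Unitary.conjStarAlgAut_apply] at h
  exact h

lemma eq_conj_inEigenbasis (ρ : Matrix n n ℂ) :
    ρ = (hσ.eigenvectorUnitary : Matrix n n ℂ) * inEigenbasis hσ ρ *
      star (hσ.eigenvectorUnitary : Matrix n n ℂ) := by
  have h := eigenvectorUnitary_mul_star hσ
  rw [inEigenbasis, ← mul_assoc, ← mul_assoc, h, one_mul, mul_assoc, h, mul_one]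

lemma inEigenbasis_self :
    inEigenbasis hσ σ = diagonal (fun i => (hσ.eigenvalues i : ℂ)) := by
  have h := star_mul_eigenvectorUnitary hσ
  have h2 := congrArg (inEigenbasis hσ) (eq_conj_diagonal hσ)
  rw [h2, inEigenbasis]
  simp only [← mul_assoc, h, one_mul]
  rw [mul_assoc, h, mul_one]

lemma eigenWeight_self (j : n) : eigenWeight hσ σ j = hσ.eigenvalues j := by
  simp [eigenWeight, inEigenbasis_self]

/-- Turns every trace against a logarithm into a scalar sum. The spectrum is finite, so `f` need not
be continuous. -/
lemma re_trace_mul_cfc (f : ℝ → ℝ) (ρ : Matrix n n ℂ) :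
    (ρ * cfc f σ).trace.re = ∑ j, eigenWeight hσ ρ j * f (hσ.eigenvalues j) := by
  rw [cfc_eq_conj_diagonal hσ, ← mul_assoc, ← mul_assoc, trace_mul_comm, ← mul_assoc, ← mul_assoc]
  simp [trace, mul_diagonal, eigenWeight, inEigenbasis]

lemma sum_eigenWeight (ρ : Matrix n n ℂ) : ∑ j, eigenWeight hσ ρ j = ρ.trace.re := by
  have h := re_trace_mul_cfc hσ (fun _ => 1) ρ
  rw [cfc_const_one ℝ σ hσ.isSelfAdjoint] at h
  simpa using h.symm

lemma inEigenbasis_posSemidef {ρ : Matrix n n ℂ} (hρ : ρ.PosSemidef) :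
    (inEigenbasis hσ ρ).PosSemidef :=
  hρ.conjTranspose_mul_mul_same _

lemma eigenWeight_nonneg {ρ : Matrix n n ℂ} (hρ : ρ.PosSemidef) (j : n) :
    0 ≤ eigenWeight hσ ρ j :=
  (Complex.le_def.1 (inEigenbasis_posSemidef hσ hρ).diag_nonneg).1

/-- For positive semidefinite `P`, `x* P x = 0` forces `P x = 0`; a zero diagonal entry therefore
kills its whole column. -/
lemma inEigenbasis_eq_zero_of_eigenWeight {ρ : Matrix n n ℂ} (hρ : ρ.PosSemidef) {j : n}
    (hj : eigenWeight hσ ρ j = 0) (i : n) : inEigenbasis hσ ρ i j = 0 := by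
  have hP := inEigenbasis_posSemidef hσ hρ
  have h0 : inEigenbasis hσ ρ j j = 0 :=
    Complex.ext hj (Complex.le_def.1 hP.diag_nonneg).2.symm
  have h1 : inEigenbasis hσ ρ *ᵥ Pi.single j 1 = 0 := by
    rw [← hP.dotProduct_mulVec_zero_iff]
    simp [h0]
  simpa using congrFun h1 i

/-- The kernel condition in terms of weights. -/
lemma eigenWeight_eq_zero {ρ : Matrix n n ℂ}
    (hker : ∀ v : n → ℂ, σ.mulVec v = 0 → ρ.mulVec v = 0) {j : n}
    (hj : hσ.eigenvalues j = 0) : eigenWeight hσ ρ j = 0 := by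
  have h := hker _ (by
    have := hσ.mulVec_eigenvectorBasis j
    rw [this, hj, zero_smul])
  have h2 : (inEigenbasis hσ ρ) *ᵥ Pi.single j 1 = 0 := by
    rw [inEigenbasis, ← mulVec_mulVec, hσ.eigenvectorUnitary_mulVec, ← mulVec_mulVec, h,
      mulVec_zero]
  have := congrFun h2 j
  simp at this
  simp [eigenWeight, this]

lemma mulVec_eq_zero_of_eigenWeight {ρ : Matrix n n ℂ} (hρ : ρ.PosSemidef)
    (hw : ∀ j, hσ.eigenvalues j = 0 → eigenWeight hσ ρ j = 0) (v : n → ℂ)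
    (hv : σ.mulVec v = 0) : ρ.mulVec v = 0 := by
  set y := star (hσ.eigenvectorUnitary : Matrix n n ℂ) *ᵥ v with hy
  have h1 : diagonal (fun i => (hσ.eigenvalues i : ℂ)) *ᵥ y = 0 := by
    have : star (hσ.eigenvectorUnitary : Matrix n n ℂ) *ᵥ (σ *ᵥ v) = 0 := by
      rw [hv, mulVec_zero]
    rw [← this, hy, ← inEigenbasis_self, mulVec_mulVec, mulVec_mulVec, inEigenbasis, mul_assoc,
      eigenvectorUnitary_mul_star, mul_one]
  have h2 : inEigenbasis hσ ρ *ᵥ y = 0 := by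
    ext i
    rw [mulVec, dotProduct]
    refine Finset.sum_eq_zero fun j _ => ?_
    have := congrFun h1 j
    simp only [mulVec_diagonal, Pi.zero_apply, mul_eq_zero, Complex.ofReal_eq_zero] at this
    rcases this with h | h
    · rw [inEigenbasis_eq_zero_of_eigenWeight hσ hρ (hw j h), zero_mul]
    · rw [h, mul_zero]
  rw [eq_conj_inEigenbasis hσ ρ, ← mulVec_mulVec, ← mulVec_mulVec, ← hy, h2, mulVec_zero]

end Eigenbasis

/-! ### Overlaps of two eigenbases and Klein's inequality -/

/-- The unitary matrix of overlaps between the eigenbases of two Hermitian matrices. -/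
noncomputable def overlap {ρ σ : Matrix n n ℂ} (hρ : ρ.IsHermitian) (hσ : σ.IsHermitian) :
    Matrix n n ℂ :=
  star (hρ.eigenvectorUnitary : Matrix n n ℂ) * (hσ.eigenvectorUnitary : Matrix n n ℂ)

section Overlap

variable {ρ σ : Matrix n n ℂ} (hρ : ρ.IsHermitian) (hσ : σ.IsHermitian)

lemma star_overlap_mul_self : star (overlap hρ hσ) * overlap hρ hσ = 1 := by
  have h := eigenvectorUnitary_mul_star hρ
  rw [overlap, star_mul, star_star, mul_assoc, ← mul_assoc (hρ.eigenvectorUnitary : Matrix n n ℂ),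
    h, one_mul, star_mul_eigenvectorUnitary]

lemma overlap_mul_star_self : overlap hρ hσ * star (overlap hρ hσ) = 1 :=
  mul_eq_one_comm.1 (star_overlap_mul_self hρ hσ)

lemma sum_normSq_overlap_left (j : n) : ∑ i, Complex.normSq (overlap hρ hσ i j) = 1 := by
  have h := congrFun (congrFun (star_overlap_mul_self hρ hσ) j) j
  simp only [mul_apply, star_apply, one_apply_eq, RCLike.star_def,
    ← Complex.normSq_eq_conj_mul_self] at h
  exact_mod_cast h

lemma sum_normSq_overlap_right (i : n) : ∑ j, Complex.normSq (overlap hρ hσ i j) = 1 := by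
  have h := congrFun (congrFun (overlap_mul_star_self hρ hσ) i) i
  simp only [mul_apply, star_apply, one_apply_eq, RCLike.star_def, Complex.mul_conj] at h
  exact_mod_cast h

lemma eigenWeight_eq_sum (j : n) :
    eigenWeight hσ ρ j = ∑ i, hρ.eigenvalues i * Complex.normSq (overlap hρ hσ i j) := by
  have h : inEigenbasis hσ ρ = star (overlap hρ hσ) *
      (diagonal (fun i => (hρ.eigenvalues i : ℂ)) * overlap hρ hσ) := by
    rw [congrArg (inEigenbasis hσ) (eq_conj_diagonal hρ), inEigenbasis]
    simp only [overlap, star_mul, star_star, mul_assoc]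
  have h2 : inEigenbasis hσ ρ j j =
      ((∑ i, hρ.eigenvalues i * Complex.normSq (overlap hρ hσ i j) : ℝ) : ℂ) := by
    rw [h, mul_apply]
    push_cast
    refine Finset.sum_congr rfl fun i _ => ?_
    rw [diagonal_mul, star_apply, RCLike.star_def, Complex.normSq_eq_conj_mul_self]
    ring
  rw [eigenWeight, h2, Complex.ofReal_re]

/-- The hypothesis says that the overlap matrix intertwines the two diagonal matrices of
eigenvalues. -/
lemma eq_of_eigenvalues_eq_of_overlap
    (h : ∀ i j, overlap hρ hσ i j = 0 ∨ hρ.eigenvalues i = hσ.eigenvalues j) : ρ = σ := by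
  have h1 : diagonal (fun i => (hρ.eigenvalues i : ℂ)) * overlap hρ hσ =
      overlap hρ hσ * diagonal (fun i => (hσ.eigenvalues i : ℂ)) := by
    ext i j
    rw [diagonal_mul, mul_diagonal]
    rcases h i j with h | h <;> rw [h]
    · simp
    · ring
  have h2 : (hρ.eigenvectorUnitary : Matrix n n ℂ) * overlap hρ hσ =
      (hσ.eigenvectorUnitary : Matrix n n ℂ) := by
    rw [overlap, ← mul_assoc, eigenvectorUnitary_mul_star, one_mul]
  have h3 : star (hρ.eigenvectorUnitary : Matrix n n ℂ) =
      overlap hρ hσ * star (hσ.eigenvectorUnitary : Matrix n n ℂ) := by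
    rw [overlap, mul_assoc, eigenvectorUnitary_mul_star, mul_one]
  rw [eq_conj_diagonal hρ, h3, mul_assoc, ← mul_assoc (diagonal _), h1, mul_assoc, ← mul_assoc, h2,
    ← mul_assoc, ← eq_conj_diagonal hσ]

end Overlap

/-- This is `log x ≤ x - 1` at `x = q / p`, strict for `x ≠ 1`. The hypothesis `h` covers `q = 0`,
where the convention `log 0 = 0` would break the bound. -/
lemma klein_term_nonneg {w p q : ℝ} (hw : 0 ≤ w) (hp : 0 ≤ p) (hq : 0 ≤ q)
    (h : q = 0 → p * w = 0) :
    0 ≤ w * (p * Real.log p - p * Real.log q - p + q) ∧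
      (w * (p * Real.log p - p * Real.log q - p + q) = 0 → w = 0 ∨ p = q) := by
  rcases hp.eq_or_lt with rfl | hp
  · simp only [zero_mul, sub_zero, zero_add]
    exact ⟨by positivity, fun h => (mul_eq_zero.1 h).imp_right Eq.symm⟩
  rcases hq.eq_or_lt with rfl | hq
  · have : w = 0 := (mul_eq_zero.1 (h rfl)).resolve_left hp.ne'
    simp [this]
  have key : p * Real.log p - p * Real.log q - p + q = p * (q / p - 1 - Real.log (q / p)) := by
    rw [Real.log_div hq.ne' hp.ne']
    field_simp
    ring
  rw [key]
  refine ⟨mul_nonneg hw (mul_nonneg hp.le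
    (sub_nonneg.2 (Real.log_le_sub_one_of_pos (by positivity)))), fun h0 => ?_⟩
  rcases mul_eq_zero.1 h0 with h0 | h0
  · exact Or.inl h0
  right
  by_contra hne
  have h1 : q / p ≠ 1 := fun h1 => hne ((div_eq_one_iff_eq hp.ne').1 h1).symm
  have := Real.log_lt_sub_one_of_pos (by positivity) h1
  exact (mul_pos hp (sub_pos.2 this)).ne' h0

/-- **Klein's inequality** together with its equality case. -/
theorem klein {ρ σ : Matrix n n ℂ} (hρ : ρ.PosSemidef) (hσ : σ.PosSemidef)
    (htr : ρ.trace = σ.trace) (hker : ∀ v : n → ℂ, σ.mulVec v = 0 → ρ.mulVec v = 0) :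
    (ρ * matLog σ).trace.re ≤ (ρ * matLog ρ).trace.re ∧
      ((ρ * matLog σ).trace.re = (ρ * matLog ρ).trace.re → ρ = σ) := by
  set p := hρ.1.eigenvalues
  set q := hσ.1.eigenvalues
  set w : n → n → ℝ := fun i j => Complex.normSq (overlap hρ.1 hσ.1 i j) with hwdef
  have hw : ∀ i j, 0 ≤ w i j := fun i j => Complex.normSq_nonneg _
  have hp : ∀ i, 0 ≤ p i := hρ.eigenvalues_nonneg
  have hq : ∀ i, 0 ≤ q i := hσ.eigenvalues_nonneg
  have hzero : ∀ i j, q j = 0 → p i * w i j = 0 := by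
    intro i j hj
    have h := eigenWeight_eq_zero hσ.1 hker hj
    rw [eigenWeight_eq_sum hρ.1 hσ.1] at h
    exact (Finset.sum_eq_zero_iff_of_nonneg
      (fun i _ => mul_nonneg (hp i) (hw i j))).1 h i (Finset.mem_univ i)
  -- The squared overlaps are doubly stochastic, so the added terms `-p i + q j` sum to `-Tr ρ + Tr
  -- σ = 0`; they make each summand nonnegative.
  have hsum : (ρ * matLog ρ).trace.re - (ρ * matLog σ).trace.re =
      ∑ i, ∑ j, w i j * (p i * Real.log (p i) - p i * Real.log (q j) - p i + q j) := by
    have e1 : (ρ * matLog ρ).trace.re = ∑ i, ∑ j, w i j * (p i * Real.log (p i)) := by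
      rw [matLog, re_trace_mul_cfc hρ.1]
      refine Finset.sum_congr rfl fun i _ => ?_
      rw [← Finset.sum_mul, sum_normSq_overlap_right, one_mul, eigenWeight_self]
    have e2 : (ρ * matLog σ).trace.re = ∑ i, ∑ j, w i j * (p i * Real.log (q j)) := by
      rw [matLog, re_trace_mul_cfc hσ.1, Finset.sum_comm]
      refine Finset.sum_congr rfl fun j _ => ?_
      rw [eigenWeight_eq_sum hρ.1 hσ.1, Finset.sum_mul]
      refine Finset.sum_congr rfl fun i _ => ?_
      simp only [hwdef]
      ring
    have e3 : ρ.trace.re = ∑ i, ∑ j, w i j * p i := by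
      rw [← sum_eigenWeight hρ.1]
      refine Finset.sum_congr rfl fun i _ => ?_
      rw [← Finset.sum_mul, sum_normSq_overlap_right, one_mul, eigenWeight_self]
    have e4 : σ.trace.re = ∑ i, ∑ j, w i j * q j := by
      rw [← sum_eigenWeight hσ.1, Finset.sum_comm]
      refine Finset.sum_congr rfl fun i _ => ?_
      rw [← Finset.sum_mul, sum_normSq_overlap_left, one_mul, eigenWeight_self]
    have e5 : ∑ i, ∑ j, w i j * p i = ∑ i, ∑ j, w i j * q j := by rw [← e3, ← e4, htr]
    simp only [mul_add, mul_sub, Finset.sum_add_distrib, Finset.sum_sub_distrib]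
    rw [e1, e2, e5]
    ring
  have hterm := fun i j => klein_term_nonneg (hw i j) (hp i) (hq j) (hzero i j)
  refine ⟨sub_nonneg.1 ?_, fun heq => ?_⟩
  · rw [hsum]
    exact Finset.sum_nonneg fun i _ => Finset.sum_nonneg fun j _ => (hterm i j).1
  · rw [heq, sub_self] at hsum
    refine eq_of_eigenvalues_eq_of_overlap hρ.1 hσ.1 fun i j => ?_
    have h1 := (Finset.sum_eq_zero_iff_of_nonneg
      (fun i _ => Finset.sum_nonneg fun j _ => (hterm i j).1)).1 hsum.symm i (Finset.mem_univ i)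
    have h2 := (Finset.sum_eq_zero_iff_of_nonneg
      (fun j _ => (hterm i j).1)).1 h1 j (Finset.mem_univ j)
    exact ((hterm i j).2 h2).imp_left Complex.normSq_eq_zero.1

end SpectralWeights

/-! ### Compactness, segments of density operators, continuity of the entropy -/

section EntropyContinuity

variable {n : Type*} [Fintype n]

lemma isClosed_isDensity : IsClosed {ρ : Matrix n n ℂ | IsDensity ρ} := by
  have h : {ρ : Matrix n n ℂ | IsDensity ρ} =
      ({ρ | ρᴴ = ρ} ∩ ⋂ x : n → ℂ, {ρ | 0 ≤ star x ⬝ᵥ (ρ *ᵥ x)}) ∩ {ρ | ρ.trace = 1} := by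
    ext ρ
    simp only [Set.mem_ofPred_eq, Set.mem_inter_iff, Set.mem_iInter]
    constructor
    · rintro ⟨h1, h2⟩
      exact ⟨⟨h1.1, h1.dotProduct_mulVec_nonneg⟩, h2⟩
    · rintro ⟨⟨h1, h2⟩, h3⟩
      exact ⟨.of_dotProduct_mulVec_nonneg h1 h2, h3⟩
  rw [h]
  refine ((isClosed_eq (by fun_prop) continuous_id).inter (isClosed_iInter fun x => ?_)).inter
    (isClosed_eq (by fun_prop) continuous_const)
  exact isClosed_le continuous_const (by fun_prop)

/-- The matrix on the affine line through `σ` (at `t = 0`) and `ρ` (at `t = 1`). -/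
noncomputable def lineMatrix (σ ρ : Matrix n n ℂ) (t : ℝ) : Matrix n n ℂ :=
  (1 - t) • σ + t • ρ

lemma trace_lineMatrix {σ ρ : Matrix n n ℂ} (hσ : σ.trace = 1) (hρ : ρ.trace = 1) (t : ℝ) :
    (lineMatrix σ ρ t).trace = 1 := by
  rw [lineMatrix, trace_add, trace_smul, trace_smul, hσ, hρ, ← add_smul, sub_add_cancel, one_smul]

lemma re_trace_lineMatrix_mul (σ ρ M : Matrix n n ℂ) (t : ℝ) :
    (lineMatrix σ ρ t * M).trace.re = (1 - t) * (σ * M).trace.re + t * (ρ * M).trace.re := by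
  simp [lineMatrix, add_mul]

lemma IsDensity.lineMatrix {σ ρ : Matrix n n ℂ} (hσ : IsDensity σ) (hρ : IsDensity ρ) {t : ℝ}
    (h0 : 0 ≤ t) (h1 : t ≤ 1) : IsDensity (lineMatrix σ ρ t) :=
  ⟨(hσ.posSemidef.smul (sub_nonneg.2 h1)).add (hρ.posSemidef.smul h0),
    trace_lineMatrix hσ.trace_eq_one hρ.trace_eq_one t⟩

/-- The kernel of a proper mixture lies in the kernels of its components. -/
lemma mulVec_eq_zero_of_lineMatrix {σ ρ : Matrix n n ℂ} (hσ : σ.PosSemidef) (hρ : ρ.PosSemidef)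
    {t : ℝ} (h0 : 0 < t) (h1 : t < 1) {v : n → ℂ} (hv : lineMatrix σ ρ t *ᵥ v = 0) :
    σ *ᵥ v = 0 ∧ ρ *ᵥ v = 0 := by
  have hA := hσ.smul (sub_nonneg.2 h1.le)
  have hB := hρ.smul h0.le
  have h : star v ⬝ᵥ (((1 - t) • σ) *ᵥ v) + star v ⬝ᵥ ((t • ρ) *ᵥ v) = 0 := by
    rw [← dotProduct_add, ← add_mulVec]
    simp only [lineMatrix] at hv
    rw [hv, dotProduct_zero]
  rw [add_eq_zero_iff_of_nonneg (hA.dotProduct_mulVec_nonneg v)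
    (hB.dotProduct_mulVec_nonneg v), hA.dotProduct_mulVec_zero_iff,
    hB.dotProduct_mulVec_zero_iff, smul_mulVec, smul_mulVec, smul_eq_zero, smul_eq_zero] at h
  exact ⟨h.1.resolve_left (sub_pos.2 h1).ne', h.2.resolve_left h0.ne'⟩

variable [DecidableEq n]

lemma IsDensity.eigenvalues_mem_Icc {ρ : Matrix n n ℂ} (hρ : IsDensity ρ) (i : n) :
    hρ.posSemidef.1.eigenvalues i ∈ Set.Icc (0 : ℝ) 1 := by
  refine ⟨hρ.posSemidef.eigenvalues_nonneg i, ?_⟩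
  have h := sum_eigenWeight hρ.posSemidef.1 ρ
  simp only [eigenWeight_self, hρ.trace_eq_one, Complex.one_re] at h
  rw [← h]
  exact Finset.single_le_sum (fun j _ => hρ.posSemidef.eigenvalues_nonneg j) (Finset.mem_univ i)

lemma IsDensity.spectrum_subset {ρ : Matrix n n ℂ} (hρ : IsDensity ρ) :
    spectrum ℝ ρ ⊆ Set.Icc 0 1 := by
  rw [hρ.posSemidef.1.spectrum_real_eq_range_eigenvalues]
  rintro _ ⟨i, rfl⟩
  exact hρ.eigenvalues_mem_Icc i

open scoped Matrix.Norms.L2Operator in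
lemma continuousOn_cfc_isDensity {f : ℝ → ℝ} (hf : ContinuousOn f (Set.Icc 0 1)) :
    ContinuousOn (cfc f : Matrix n n ℂ → Matrix n n ℂ) {ρ | IsDensity ρ} :=
  (continuousOn_cfc (Matrix n n ℂ) isCompact_Icc f hf).mono fun _ hρ =>
    ⟨hρ.posSemidef.1, hρ.spectrum_subset⟩

open scoped Matrix.Norms.L2Operator in
lemma isCompact_of_isDensity {K : Set (Matrix n n ℂ)} (hK : ∀ σ ∈ K, IsDensity σ)
    (hc : IsClosed K) : IsCompact K := by
  have : ProperSpace (Matrix n n ℂ) := FiniteDimensional.proper ℂ _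
  refine Metric.isCompact_of_isClosed_isBounded hc ?_
  refine (Metric.isBounded_closedBall (x := 0) (r := 1)).subset fun σ hσ => ?_
  rw [mem_closedBall_zero_iff]
  have hd := hK σ hσ
  rw [← cfc_id ℝ σ hd.posSemidef.1.isSelfAdjoint]
  refine norm_cfc_le zero_le_one fun x hx => ?_
  have := hd.spectrum_subset hx
  rw [id, Real.norm_of_nonneg this.1]
  exact this.2

/-- Unlike `log`, the function `-x log x` is continuous at `0`, so this form gives continuity of the
entropy. -/
lemma entropy_eq_trace_cfc {ρ : Matrix n n ℂ} (hρ : ρ.IsHermitian) :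
    entropy ρ = (cfc Real.negMulLog ρ).trace.re := by
  have h := re_trace_mul_cfc hρ Real.negMulLog 1
  rw [one_mul] at h
  have h1 : ∀ j, eigenWeight hρ 1 j = 1 := fun j => by
    simp [eigenWeight, inEigenbasis]
  rw [h, entropy, matLog, re_trace_mul_cfc hρ, ← Finset.sum_neg_distrib]
  refine Finset.sum_congr rfl fun j _ => ?_
  rw [eigenWeight_self, h1, Real.negMulLog]
  ring

lemma continuousOn_entropy :
    ContinuousOn (entropy : Matrix n n ℂ → ℝ) {ρ | IsDensity ρ} := by
  have h := continuousOn_cfc_isDensity (n := n) Real.continuous_negMulLog.continuousOn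
  refine ContinuousOn.congr (f := fun ρ => (cfc Real.negMulLog ρ).trace.re) ?_
    fun ρ hρ => entropy_eq_trace_cfc hρ.posSemidef.1
  exact (Complex.continuous_re.comp (continuous_id.matrix_trace)).comp_continuousOn h

/-! ### First-order condition at an entropy maximizer -/

/-- The shift by `ε` makes the logarithm continuous on `[0, 1]`, so that `t → 0` can be taken before
anything is known about the kernel of `σ`. -/
lemma sum_weight_mul_log_add_ge {σ ρ : Matrix n n ℂ} (hσ : IsDensity σ) (hρ : IsDensity ρ)
    (hmax : ∀ t : ℝ, 0 < t → t < 1 → entropy (lineMatrix σ ρ t) ≤ entropy σ)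
    {ε : ℝ} (hε : 0 < ε) :
    -entropy σ ≤ ∑ j, eigenWeight hσ.posSemidef.1 ρ j *
      Real.log (hσ.posSemidef.1.eigenvalues j + ε) := by
  have hf : ContinuousOn (fun x => Real.log (x + ε)) (Set.Icc 0 1) := by
    refine ContinuousOn.log (by fun_prop) fun x hx => ?_
    have := hx.1
    positivity
  rw [← re_trace_mul_cfc hσ.posSemidef.1 (fun x => Real.log (x + ε))]
  have hline : Tendsto (lineMatrix σ ρ) (𝓝[>] 0) (𝓝[{ρ | IsDensity ρ}] σ) := by
    refine tendsto_nhdsWithin_iff.2 ⟨?_, ?_⟩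
    · have hc : Continuous (lineMatrix σ ρ) := by unfold lineMatrix; fun_prop
      have := hc.tendsto 0
      simp only [lineMatrix, sub_zero, one_smul, zero_smul, add_zero] at this
      exact this.mono_left nhdsWithin_le_nhds
    · filter_upwards [Ioo_mem_nhdsGT (zero_lt_one (α := ℝ))] with t ht
      exact hσ.lineMatrix hρ ht.1.le ht.2.le
  have hlim : Tendsto (fun t => (ρ * cfc (fun x => Real.log (x + ε)) (lineMatrix σ ρ t)).trace.re)
      (𝓝[>] 0) (𝓝 (ρ * cfc (fun x => Real.log (x + ε)) σ).trace.re) := by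
    have h1 := (continuousOn_cfc_isDensity (n := n) hf σ hσ).tendsto.comp hline
    have h2 : Continuous fun M : Matrix n n ℂ => (ρ * M).trace.re :=
      Complex.continuous_re.comp (by fun_prop)
    exact (h2.tendsto _).comp h1
  refine ge_of_tendsto hlim ?_
  filter_upwards [Ioo_mem_nhdsGT (zero_lt_one (α := ℝ))] with t ht
  have hd := hσ.lineMatrix hρ ht.1.le ht.2.le
  have hker := fun v hv => mulVec_eq_zero_of_lineMatrix hσ.posSemidef hρ.posSemidef ht.1 ht.2
    (v := v) hv
  have hkl := (klein hσ.posSemidef hd.posSemidef (hσ.trace_eq_one.trans hd.trace_eq_one.symm)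
    fun v hv => (hker v hv).1).1
  have hm := hmax t ht.1 ht.2
  rw [entropy, entropy, neg_le_neg_iff, re_trace_lineMatrix_mul] at hm
  -- Klein's inequality bounds the `(1 - t)` part of `hm` by `(1 - t) Tr σ log σ`; what remains is
  -- divided by `t`.
  have h1 : -entropy σ ≤ (ρ * matLog (lineMatrix σ ρ t)).trace.re := by
    rw [entropy, neg_neg]
    have h3 := mul_le_mul_of_nonneg_left hkl (sub_nonneg.2 ht.2.le)
    have h4 : t * (σ * matLog σ).trace.re ≤ t * (ρ * matLog (lineMatrix σ ρ t)).trace.re := by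
      linarith
    exact le_of_mul_le_mul_left h4 ht.1
  refine h1.trans ?_
  rw [matLog, re_trace_mul_cfc hd.posSemidef.1, re_trace_mul_cfc hd.posSemidef.1]
  refine Finset.sum_le_sum fun j _ => ?_
  -- Monotonicity of `log` fails at eigenvalue `0` because `log 0 = 0`, but there the weight of `ρ`
  -- vanishes.
  rcases (hd.posSemidef.eigenvalues_nonneg j).eq_or_lt with h | h
  · rw [eigenWeight_eq_zero hd.posSemidef.1 (fun v hv => (hker v hv).2) h.symm, zero_mul, zero_mul]
  · exact mul_le_mul_of_nonneg_left (Real.log_le_log h (by linarith))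
      (eigenWeight_nonneg _ hρ.posSemidef j)

/-- A positive weight on the kernel of `σ` would drive the `ε`-shifted sum to `-∞` as `ε → 0`,
against its fixed lower bound. -/
lemma eigenWeight_eq_zero_of_entropy_le {σ ρ : Matrix n n ℂ} (hσ : IsDensity σ) (hρ : IsDensity ρ)
    (hmax : ∀ t : ℝ, 0 < t → t < 1 → entropy (lineMatrix σ ρ t) ≤ entropy σ) (j : n)
    (hj : hσ.posSemidef.1.eigenvalues j = 0) : eigenWeight hσ.posSemidef.1 ρ j = 0 := by
  set w := eigenWeight hσ.posSemidef.1 ρ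
  have hw : ∀ j, 0 ≤ w j := eigenWeight_nonneg _ hρ.posSemidef
  by_contra hne
  have hpos : 0 < w j := (hw j).lt_of_ne' hne
  -- With `ε = exp (-x) ≤ 1` the other terms total at most `(∑ w) log 2`, and the `j`-th is `-w j *
  -- x = -(|C| + 1)`; the lower bound would give `|C| + 1 ≤ C`.
  set C := entropy σ + (∑ k, w k) * Real.log 2 with hC
  set x := (|C| + 1) / w j with hx
  have hx0 : 0 < x := by positivity
  have h := sum_weight_mul_log_add_ge hσ hρ hmax (Real.exp_pos (-x))
  rw [← Finset.add_sum_erase _ _ (Finset.mem_univ j), hj, zero_add, Real.log_exp] at h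
  have h2 : ∑ k ∈ Finset.univ.erase j,
      w k * Real.log (hσ.posSemidef.1.eigenvalues k + Real.exp (-x)) ≤
      (∑ k, w k) * Real.log 2 := by
    rw [Finset.sum_mul]
    refine (Finset.sum_le_sum fun k _ => mul_le_mul_of_nonneg_left
      (Real.log_le_log ?_ ?_) (hw k)).trans (Finset.sum_le_sum_of_subset_of_nonneg
        (Finset.erase_subset _ _) fun k _ _ => mul_nonneg (hw k) (Real.log_nonneg one_le_two))
    · exact add_pos_of_nonneg_of_pos (hσ.posSemidef.eigenvalues_nonneg k) (Real.exp_pos _)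
    · have h1 := (hσ.eigenvalues_mem_Icc k).2
      have h3 : Real.exp (-x) ≤ 1 := Real.exp_le_one_iff.2 (by linarith)
      linarith
  have h3 : w j * -x = -(|C| + 1) := by
    rw [hx]
    field_simp
  have h4 := le_abs_self C
  have h5 : eigenWeight hσ.posSemidef.1 ρ j * -x = w j * -x := rfl
  rw [h5, h3] at h
  linarith

/-- A density operator of largest entropy on the segment towards `ρ` satisfies the variational
inequality `Tr[ρ log σ] ≥ Tr[σ log σ]`. -/
lemma re_trace_mul_matLog_ge_of_entropy_le {σ ρ : Matrix n n ℂ} (hσ : IsDensity σ)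
    (hρ : IsDensity ρ)
    (hmax : ∀ t : ℝ, 0 < t → t < 1 → entropy (lineMatrix σ ρ t) ≤ entropy σ) :
    (σ * matLog σ).trace.re ≤ (ρ * matLog σ).trace.re := by
  rw [← neg_neg (σ * matLog σ).trace.re]
  change -entropy σ ≤ _
  rw [matLog, re_trace_mul_cfc hσ.posSemidef.1]
  have hlim : Tendsto (fun ε => ∑ j, eigenWeight hσ.posSemidef.1 ρ j *
      Real.log (hσ.posSemidef.1.eigenvalues j + ε)) (𝓝[>] 0)
      (𝓝 (∑ j, eigenWeight hσ.posSemidef.1 ρ j * Real.log (hσ.posSemidef.1.eigenvalues j))) := by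
    refine tendsto_finsetSum _ fun j _ => ?_
    -- On the kernel the diverging logarithm is multiplied by weight zero.
    by_cases hj : hσ.posSemidef.1.eigenvalues j = 0
    · rw [eigenWeight_eq_zero_of_entropy_le hσ hρ hmax j hj]
      simp
    · refine Tendsto.const_mul _ ?_
      have h : Tendsto (fun ε : ℝ => hσ.posSemidef.1.eigenvalues j + ε) (𝓝[>] 0)
          (𝓝 (hσ.posSemidef.1.eigenvalues j)) := by
        have : Continuous fun ε : ℝ => hσ.posSemidef.1.eigenvalues j + ε := by fun_prop
        have := this.tendsto 0
        rw [add_zero] at this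
        exact this.mono_left nhdsWithin_le_nhds
      exact h.log hj
  refine ge_of_tendsto hlim ?_
  filter_upwards [self_mem_nhdsWithin] with ε hε
  exact sum_weight_mul_log_add_ge hσ hρ hmax hε

open scoped MatrixOrder Matrix.Norms.L2Operator in
/-- If the diagonal of `ρ` in the eigenbasis of `σ` vanishes on the kernel of `σ`, then `ρ` is
dominated by a multiple of `σ`. -/
lemma exists_smul_sub_posSemidef {σ ρ : Matrix n n ℂ} (hσ : σ.PosSemidef) (hρ : ρ.PosSemidef)
    (hw : ∀ j, hσ.1.eigenvalues j = 0 → eigenWeight hσ.1 ρ j = 0) :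
    ∃ M : ℝ, 0 ≤ M ∧ (M • σ - ρ).PosSemidef := by
  set l := hσ.1.eigenvalues
  set D : Matrix n n ℂ := diagonal fun i => ((√(l i) : ℝ) : ℂ) with hD
  set Q : Matrix n n ℂ := diagonal fun i => (((√(l i))⁻¹ : ℝ) : ℂ) with hQ
  have hDs : Dᴴ = D := by rw [hD, diagonal_conjTranspose]; congr 1; ext i; simp
  have hQs : Qᴴ = Q := by rw [hQ, diagonal_conjTranspose]; congr 1; ext i; simp
  -- `R` is `σ^(-1/2) ρ σ^(-1/2)` in the eigenbasis, with `0⁻¹ = 0` on the kernel. Conjugating `R ≤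
  -- ‖R‖` by `σ^(1/2)` gives the claim with `M = ‖R‖`; `ρ` is recovered since its kernel rows and
  -- columns vanish.
  set R := Q * inEigenbasis hσ.1 ρ * Q with hR
  have hRp : R.PosSemidef := by
    have := (inEigenbasis_posSemidef hσ.1 hρ).conjTranspose_mul_mul_same Q
    rwa [hQs] at this
  have hle : R ≤ algebraMap ℝ _ ‖R‖ := IsSelfAdjoint.le_algebraMap_norm_self hRp.1.isSelfAdjoint
  refine ⟨‖R‖, norm_nonneg _, ?_⟩
  have h1 : (algebraMap ℝ (Matrix n n ℂ) ‖R‖ - R).PosSemidef := hle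
  have h2 := (h1.conjTranspose_mul_mul_same D).mul_mul_conjTranspose_same
    (hσ.1.eigenvectorUnitary : Matrix n n ℂ)
  convert h2 using 1
  have h3 : D * R * D = inEigenbasis hσ.1 ρ := by
    ext i j
    rw [hR, hD, hQ, mul_diagonal, diagonal_mul, mul_diagonal, diagonal_mul]
    by_cases hi : l i = 0
    · have : inEigenbasis hσ.1 ρ i j = 0 := by
        rw [← (inEigenbasis_posSemidef hσ.1 hρ).1.apply i j,
          inEigenbasis_eq_zero_of_eigenWeight hσ.1 hρ (hw i hi), star_zero]
      rw [this]
      ring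
    by_cases hj : l j = 0
    · rw [inEigenbasis_eq_zero_of_eigenWeight hσ.1 hρ (hw j hj)]
      ring
    have hi' : ((√(l i) : ℝ) : ℂ) ≠ 0 := Complex.ofReal_ne_zero.2
      (Real.sqrt_ne_zero'.2 ((hσ.eigenvalues_nonneg i).lt_of_ne' hi))
    have hj' : ((√(l j) : ℝ) : ℂ) ≠ 0 := Complex.ofReal_ne_zero.2
      (Real.sqrt_ne_zero'.2 ((hσ.eigenvalues_nonneg j).lt_of_ne' hj))
    push_cast
    field_simp
  have h4 : D * D = diagonal fun i => (l i : ℂ) := by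
    rw [hD, diagonal_mul_diagonal]
    congr 1
    ext i
    rw [← Complex.ofReal_mul, Real.mul_self_sqrt (hσ.eigenvalues_nonneg i)]
  have h5 : Dᴴ * (algebraMap ℝ (Matrix n n ℂ) ‖R‖ - R) * D =
      ‖R‖ • (diagonal fun i => (l i : ℂ)) - inEigenbasis hσ.1 ρ := by
    rw [hDs, mul_sub, sub_mul, h3, Algebra.algebraMap_eq_smul_one, mul_smul_comm, mul_one,
      smul_mul_assoc, h4]
  rw [h5, mul_sub, sub_mul, mul_smul_comm, smul_mul_assoc]
  change _ = ‖R‖ • (_ * _ * star _) - _ * _ * star _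
  rw [← eq_conj_diagonal hσ.1, ← eq_conj_inEigenbasis hσ.1]

end EntropyContinuity

/-! ### Maximum entropy over an affine section of the density operators -/

section MaxEntropy

variable {n : Type*} [Fintype n] [DecidableEq n]

/-- In `hline` the parameter `t` is any real number: `K` is an affine section and not merely convex,
which later permits steps beyond `σ`. -/
lemma IsMaxEntropyEstimator.entropy_lineMatrix_le {K : Set (Matrix n n ℂ)}
    (hK : ∀ σ ∈ K, IsDensity σ)
    (hline : ∀ σ ∈ K, ∀ ρ ∈ K, ∀ t : ℝ, IsDensity (lineMatrix σ ρ t) → lineMatrix σ ρ t ∈ K)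
    {σ ρ : Matrix n n ℂ} (hσ : IsMaxEntropyEstimator K σ) (hρ : ρ ∈ K) (t : ℝ) (h0 : 0 < t)
    (h1 : t < 1) : entropy (lineMatrix σ ρ t) ≤ entropy σ :=
  hσ.2 _ (hline σ hσ.1 ρ hρ t ((hK σ hσ.1).lineMatrix (hK ρ hρ) h0.le h1.le))

/-- The kernel of a maximum entropy estimator over an affine section `K` of the density operators
is contained in the kernel of every element of `K`. -/
lemma IsMaxEntropyEstimator.mulVec_eq_zero {K : Set (Matrix n n ℂ)}
    (hK : ∀ σ ∈ K, IsDensity σ)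
    (hline : ∀ σ ∈ K, ∀ ρ ∈ K, ∀ t : ℝ, IsDensity (lineMatrix σ ρ t) → lineMatrix σ ρ t ∈ K)
    {σ ρ : Matrix n n ℂ} (hσ : IsMaxEntropyEstimator K σ) (hρ : ρ ∈ K) (v : n → ℂ)
    (hv : σ.mulVec v = 0) : ρ.mulVec v = 0 :=
  mulVec_eq_zero_of_eigenWeight (hK σ hσ.1).posSemidef.1 (hK ρ hρ).posSemidef
    (eigenWeight_eq_zero_of_entropy_le (hK σ hσ.1) (hK ρ hρ)
      (hσ.entropy_lineMatrix_le hK hline hρ)) v hv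

/-- Every element of `K` has the same expectation of `log σ` as the maximum entropy estimator `σ`,
because the segment from it to `σ` can be prolonged beyond `σ` inside `K`. -/
lemma IsMaxEntropyEstimator.re_trace_mul_matLog_eq {K : Set (Matrix n n ℂ)}
    (hK : ∀ σ ∈ K, IsDensity σ)
    (hline : ∀ σ ∈ K, ∀ ρ ∈ K, ∀ t : ℝ, IsDensity (lineMatrix σ ρ t) → lineMatrix σ ρ t ∈ K)
    {σ ρ : Matrix n n ℂ} (hσ : IsMaxEntropyEstimator K σ) (hρ : ρ ∈ K) :
    (ρ * matLog σ).trace.re = (σ * matLog σ).trace.re := by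
  have hσd := hK σ hσ.1
  have hρd := hK ρ hρ
  have hge := fun τ (hτ : τ ∈ K) => re_trace_mul_matLog_ge_of_entropy_le hσd (hK τ hτ)
    (hσ.entropy_lineMatrix_le hK hline hτ)
  refine le_antisymm ?_ (hge ρ hρ)
  obtain ⟨M, hM, hMP⟩ := exists_smul_sub_posSemidef hσd.posSemidef hρd.posSemidef
    (eigenWeight_eq_zero_of_entropy_le hσd hρd (hσ.entropy_lineMatrix_le hK hline hρ))
  -- This choice gives `1 + s = s (M + 2)`, hence `(1 + s)σ - sρ = s ((Mσ - ρ) + 2σ)`, which is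
  -- positive semidefinite.
  set s := (M + 1)⁻¹ with hs
  have hs0 : 0 < s := by positivity
  have hsM : s * (M + 1) = 1 := inv_mul_cancel₀ (by positivity)
  have hd : IsDensity (lineMatrix σ ρ (-s)) := by
    refine ⟨?_, trace_lineMatrix hσd.trace_eq_one hρd.trace_eq_one _⟩
    have h := (hMP.add (hσd.posSemidef.smul (zero_le_two (α := ℝ)))).smul hs0.le
    convert h using 1
    have h1 : 1 - -s = s * M + s * 2 := by linarith
    rw [lineMatrix, h1]
    module
  -- At the negative parameter `-s` the variational inequality reverses sign.
  have h := hge _ (hline σ hσ.1 ρ hρ _ hd)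
  rw [re_trace_lineMatrix_mul] at h
  have h2 : s * (ρ * matLog σ).trace.re ≤ s * (σ * matLog σ).trace.re := by linarith
  exact le_of_mul_le_mul_left h2 hs0

/-- The Pythagorean identity for the maximum entropy estimator. -/
theorem IsMaxEntropyEstimator.relEntropy_eq {K : Set (Matrix n n ℂ)}
    (hK : ∀ σ ∈ K, IsDensity σ)
    (hline : ∀ σ ∈ K, ∀ ρ ∈ K, ∀ t : ℝ, IsDensity (lineMatrix σ ρ t) → lineMatrix σ ρ t ∈ K)
    {σ ρ : Matrix n n ℂ} (hσ : IsMaxEntropyEstimator K σ) (hρ : ρ ∈ K) :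
    relEntropy ρ σ = ((entropy σ - entropy ρ : ℝ) : EReal) := by
  rw [relEntropy, if_pos (hσ.mulVec_eq_zero hK hline hρ)]
  congr 1
  rw [mul_sub, trace_sub, Complex.sub_re, hσ.re_trace_mul_matLog_eq hK hline hρ, entropy, entropy]
  ring

/-- Existence is compactness. Uniqueness needs no strict concavity: a second maximizer `τ` has `Tr τ
log σ = Tr σ log σ = Tr τ log τ`, the equality case of `klein`. -/
theorem existsUnique_isMaxEntropyEstimator {K : Set (Matrix n n ℂ)}
    (hK : ∀ σ ∈ K, IsDensity σ) (hc : IsClosed K) (hne : K.Nonempty)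
    (hline : ∀ σ ∈ K, ∀ ρ ∈ K, ∀ t : ℝ, IsDensity (lineMatrix σ ρ t) → lineMatrix σ ρ t ∈ K) :
    ∃! σ, IsMaxEntropyEstimator K σ := by
  obtain ⟨σ, hσ, hmax⟩ := (isCompact_of_isDensity hK hc).exists_isMaxOn hne
    (continuousOn_entropy.mono hK)
  have hσe : IsMaxEntropyEstimator K σ := ⟨hσ, hmax⟩
  refine ⟨σ, hσe, fun τ hτ => ?_⟩
  refine (klein (hK τ hτ.1).posSemidef (hK σ hσ).posSemidef
    ((hK τ hτ.1).trace_eq_one.trans (hK σ hσ).trace_eq_one.symm)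
    (hσe.mulVec_eq_zero hK hline hτ.1)).2 ?_
  have h := le_antisymm (hτ.2 σ hσ) (hσe.2 τ hτ.1)
  rw [entropy, entropy, neg_inj] at h
  rw [hσe.re_trace_mul_matLog_eq hK hline hτ.1, h]

end MaxEntropy

/-! ### Compatibility sets are closed affine sections -/

section Marginals

variable {a b c : Type*}

lemma continuous_marginalAB [Fintype c] :
    Continuous (marginalAB : Matrix (a × b × c) (a × b × c) ℂ → Matrix (a × b) (a × b) ℂ) :=
  continuous_matrix fun _ _ => continuous_finsetSum _ fun _ _ => continuous_id.matrix_elem _ _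

lemma continuous_marginalBC [Fintype a] :
    Continuous (marginalBC : Matrix (a × b × c) (a × b × c) ℂ → Matrix (b × c) (b × c) ℂ) :=
  continuous_matrix fun _ _ => continuous_finsetSum _ fun _ _ => continuous_id.matrix_elem _ _

lemma continuous_marginalAC [Fintype b] :
    Continuous (marginalAC : Matrix (a × b × c) (a × b × c) ℂ → Matrix (a × c) (a × c) ℂ) :=
  continuous_matrix fun _ _ => continuous_finsetSum _ fun _ _ => continuous_id.matrix_elem _ _

lemma lineMatrix_self {n : Type*} (M : Matrix n n ℂ) (t : ℝ) : lineMatrix M M t = M := by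
  rw [lineMatrix, ← add_smul, sub_add_cancel, one_smul]

lemma marginalAB_lineMatrix [Fintype c]
    (σ ρ : Matrix (a × b × c) (a × b × c) ℂ) (t : ℝ) :
    marginalAB (lineMatrix σ ρ t) = lineMatrix (marginalAB σ) (marginalAB ρ) t := by
  ext i j
  simp [marginalAB, lineMatrix, Finset.sum_add_distrib, Finset.mul_sum]

lemma marginalBC_lineMatrix [Fintype a]
    (σ ρ : Matrix (a × b × c) (a × b × c) ℂ) (t : ℝ) :
    marginalBC (lineMatrix σ ρ t) = lineMatrix (marginalBC σ) (marginalBC ρ) t := by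
  ext i j
  simp [marginalBC, lineMatrix, Finset.sum_add_distrib, Finset.mul_sum]

lemma marginalAC_lineMatrix [Fintype b]
    (σ ρ : Matrix (a × b × c) (a × b × c) ℂ) (t : ℝ) :
    marginalAC (lineMatrix σ ρ t) = lineMatrix (marginalAC σ) (marginalAC ρ) t := by
  ext i j
  simp [marginalAC, lineMatrix, Finset.sum_add_distrib, Finset.mul_sum]

variable [Fintype a] [Fintype b] [Fintype c] {ρAB : Matrix (a × b) (a × b) ℂ} {ρBC : Matrix (b × c) (b × c) ℂ}
  {ρAC : Matrix (a × c) (a × c) ℂ}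

lemma isDensity_of_mem_comp {C : MarginalPair} {σ : Matrix (a × b × c) (a × b × c) ℂ}
    (hσ : σ ∈ Comp ρAB ρBC ρAC C) : IsDensity σ := by
  cases C <;> exact hσ.1

lemma isClosed_comp (C : MarginalPair) : IsClosed (Comp ρAB ρBC ρAC C) := by
  have hAB := isClosed_eq (continuous_marginalAB (a := a) (b := b) (c := c))
    (continuous_const (y := ρAB))
  have hBC := isClosed_eq (continuous_marginalBC (a := a) (b := b) (c := c))
    (continuous_const (y := ρBC))
  have hAC := isClosed_eq (continuous_marginalAC (a := a) (b := b) (c := c))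
    (continuous_const (y := ρAC))
  cases C
  · exact isClosed_isDensity.inter (hAB.inter hBC)
  · exact isClosed_isDensity.inter (hBC.inter hAC)
  · exact isClosed_isDensity.inter (hAB.inter hAC)

/-- Partial traces are linear, so marginals shared by two points are constant along their line. -/
lemma lineMatrix_mem_comp (C : MarginalPair) (σ : Matrix (a × b × c) (a × b × c) ℂ)
    (hσ : σ ∈ Comp ρAB ρBC ρAC C) (ρ : Matrix (a × b × c) (a × b × c) ℂ)
    (hρ : ρ ∈ Comp ρAB ρBC ρAC C) (t : ℝ) (hd : IsDensity (lineMatrix σ ρ t)) :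
    lineMatrix σ ρ t ∈ Comp ρAB ρBC ρAC C := by
  cases C <;> obtain ⟨-, h1, h2⟩ := hσ <;> obtain ⟨-, h3, h4⟩ := hρ <;> refine ⟨hd, ?_, ?_⟩ <;>
    simp only [marginalAB_lineMatrix, marginalBC_lineMatrix, marginalAC_lineMatrix, h1, h2, h3, h4,
      lineMatrix_self]

end Marginals

end Quantum

theorem theorem5 {a b c : Type*} [Fintype a] [Fintype b] [Fintype c]
    [DecidableEq a] [DecidableEq b] [DecidableEq c]
    (ρAB : Matrix (a × b) (a × b) ℂ) (ρBC : Matrix (b × c) (b × c) ℂ)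
    (ρAC : Matrix (a × c) (a × c) ℂ)
    (ρ : Matrix (a × b × c) (a × b × c) ℂ) (hρ : Quantum.IsDensity ρ)
    (hAB : Quantum.marginalAB ρ = ρAB) (hBC : Quantum.marginalBC ρ = ρBC)
    (hAC : Quantum.marginalAC ρ = ρAC) :
    (∀ C : Quantum.MarginalPair,
      ∃! σ, Quantum.IsMaxEntropyEstimator (Quantum.Comp ρAB ρBC ρAC C) σ) ∧
    ∀ est : Quantum.MarginalPair → Matrix (a × b × c) (a × b × c) ℂ,
      (∀ C, Quantum.IsMaxEntropyEstimator (Quantum.Comp ρAB ρBC ρAC C) (est C)) →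
      (∀ C, Quantum.relEntropy ρ (est C) =
        ((Quantum.entropy (est C) - Quantum.entropy ρ : ℝ) : EReal)) ∧
      (∀ C, (∀ C', Quantum.relEntropy ρ (est C) ≤ Quantum.relEntropy ρ (est C')) ↔
        ∀ C', Quantum.entropy (est C) ≤ Quantum.entropy (est C')) := by
  have hmem : ∀ C, ρ ∈ Quantum.Comp ρAB ρBC ρAC C := fun C => by
    cases C
    · exact ⟨hρ, hAB, hBC⟩
    · exact ⟨hρ, hBC, hAC⟩
    · exact ⟨hρ, hAB, hAC⟩
  refine ⟨fun C => Quantum.existsUnique_isMaxEntropyEstimator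
    (fun _ => Quantum.isDensity_of_mem_comp) (Quantum.isClosed_comp C) ⟨ρ, hmem C⟩
    (Quantum.lineMatrix_mem_comp C), fun est hest => ?_⟩
  have hrel : ∀ C, Quantum.relEntropy ρ (est C) =
      ((Quantum.entropy (est C) - Quantum.entropy ρ : ℝ) : EReal) := fun C =>
    (hest C).relEntropy_eq (fun _ => Quantum.isDensity_of_mem_comp)
      (Quantum.lineMatrix_mem_comp C) (hmem C)
  refine ⟨hrel, fun C => forall_congr' fun C' => ?_⟩
  -- The two orderings agree because all three differences subtract the same finite `S(ρ)`.
  rw [hrel, hrel, EReal.coe_le_coe_iff, sub_le_sub_iff_right]
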